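/- Let $m\ge 1$ be an integer. A seller offers $m$ goods to one buyer with additive valuations $x=(x_1,\dots,x_m)\in D=[0,\infty)^m$, where the $x_j$ are independent and $x_j$ is exponentially distributed with parameter $\lambda_j>0$; let $F$ be the law of $x$. A mechanism consists of an allocation function $a:D\to[0,1]^m$ and a payment function $p:D\to[0,\infty)$. It is individually rational if $a(x)\cdot x-p(x)\ge 0$ for all $x\in D$, and incentive compatible if $a(x)\cdot x-p(x)\ge a(x')\cdot x-p(x')$ for all $x,x'\in D$. The optimal revenue $\mathrm{Rev}(F)$ is the supremum of $\mathbb E_{x\sim F}[p(x)]$ over all individually rational and incentive compatible mechanisms. In terms of utility functions, it is the supremum of $\int_D(\nabla u(x)\cdot x-u(x))\,dF(x)$ over all nonnegative convex $u:D\to\mathbb R$ with $0\le\partial u/\partial x_j\le 1$ almost everywhere in $D$ for every $j$. For $w\ge 0$ let $\Gamma(k,w)=\int_w^\infty t^{k-1}e^{-t}\,dt$ and $g(m,w)=\Gamma(m+1,w)-(m+1)\Gamma(m,w)$, and let $G(m)=\int_0^\infty\max\{0,g(m,w)\}\,dw$. Theorem. The function $g(m,\cdot)$ has a unique root $\gamma^*_m$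 in $[0,\infty)$, and $$G(m)=\int_{\gamma^*_m}^\infty g(m,w)\,dw=\gamma^*_m\,\Gamma(m,\gamma^*_m)=(\gamma^*_m)^{m+1}e^{-\gamma^*_m}.$$ With either of the two descriptions of the optimal revenue, $$\mathrm{Rev}(F)\le\frac{G(m)}{m!}\sum_{j=1}^m\frac1{\lambda_j}.$$ In the special case $\lambda_1=\dots=\lambda_m=\lambda$ this bound reads $$\mathrm{Rev}(F)\le\frac{G(m)}{(m-1)!\,\lambda}.$$ -/

import Mathlib

open MeasureTheory ProbabilityTheory

noncomputable section

namespace OptimalSelling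

/-! ### Selling mechanisms for `m` goods and one additive buyer

Functions on the valuation domain `D ⊆ ℝ^m` are represented by functions on `ℝ^m`;
only their values on `D` are constrained. -/

/-- A direct revelation selling mechanism on the valuation domain `D`: good `j` is sold with
probability `alloc x j`, for a total nonnegative payment `pay x`, when the buyer reports `x`. -/
structure Mechanism {m : ℕ} (D : Set (Fin m → ℝ)) where
  alloc : (Fin m → ℝ) → Fin m → ℝ
  pay : (Fin m → ℝ) → ℝ
  alloc_mem : ∀ x ∈ D, ∀ j, alloc x j ∈ Set.Icc (0 : ℝ) 1
  pay_nonneg : ∀ x ∈ D, 0 ≤ pay x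

namespace Mechanism

variable {m : ℕ} {D : Set (Fin m → ℝ)}

/-- The utility of a buyer with true valuations `x` who reports `x'`. -/
def utility (M : Mechanism D) (x' x : Fin m → ℝ) : ℝ :=
  ∑ j, M.alloc x' j * x j - M.pay x'

/-- Individual rationality. -/
def IsIR (M : Mechanism D) : Prop :=
  ∀ x ∈ D, 0 ≤ M.utility x x

/-- Incentive compatibility. -/
def IsIC (M : Mechanism D) : Prop :=
  ∀ x ∈ D, ∀ x' ∈ D, M.utility x' x ≤ M.utility x x

/-- The expected payment when the valuations are drawn from `F`. The payment is nonnegative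
on `D`, so this is an integral with values in `[0, ∞]`. -/
def expectedRevenue (M : Mechanism D) (F : Measure (Fin m → ℝ)) : ENNReal :=
  ∫⁻ x, ENNReal.ofReal (M.pay x) ∂F

end Mechanism

/-- The optimal revenue: the supremum of the expected revenue over all (possibly randomized)
mechanisms on `D` that are individually rational and incentive compatible. -/
def optimalRevenue {m : ℕ} (D : Set (Fin m → ℝ)) (F : Measure (Fin m → ℝ)) : EReal :=
  ⨆ (M : Mechanism D) (_ : M.IsIR ∧ M.IsIC), (M.expectedRevenue F : EReal)

/-! ### The formulation through utility functions -/

/-- The partial derivative of `u` with respect to the `j`-th coordinate. -/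
def partialDeriv {m : ℕ} (u : (Fin m → ℝ) → ℝ) (j : Fin m) (x : Fin m → ℝ) : ℝ :=
  fderiv ℝ u x (Pi.single j 1)

/-- `u` is a nonnegative convex function on `D` whose partial derivatives (which exist) lie
in `[0, 1]` almost everywhere in `D`. -/
structure IsFeasibleUtility {m : ℕ} (D : Set (Fin m → ℝ)) (u : (Fin m → ℝ) → ℝ) : Prop where
  nonneg : ∀ x ∈ D, 0 ≤ u x
  convex : ConvexOn ℝ D u
  partialDeriv_mem : ∀ᵐ x ∂(volume.restrict D),
    DifferentiableAt ℝ u x ∧ ∀ j, partialDeriv u j x ∈ Set.Icc (0 : ℝ) 1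

/-- `R(u; F) = ∫_D (∇u(x) · x - u(x)) dF(x)`. -/
def utilityRevenue {m : ℕ} (D : Set (Fin m → ℝ)) (F : Measure (Fin m → ℝ))
    (u : (Fin m → ℝ) → ℝ) : ℝ :=
  ∫ x in D, (∑ j, partialDeriv u j x * x j - u x) ∂F

/-- The supremum of `R(u; F)` over all feasible utility functions `u`. -/
def optimalUtilityRevenue {m : ℕ} (D : Set (Fin m → ℝ)) (F : Measure (Fin m → ℝ)) : EReal :=
  ⨆ (u : (Fin m → ℝ) → ℝ) (_ : IsFeasibleUtility D u), (utilityRevenue D F u : EReal)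

/-! ### Exponential valuations -/

/-- The nonnegative orthant of `ℝ^m`. -/
def orthant (m : ℕ) : Set (Fin m → ℝ) :=
  {x | ∀ j, 0 ≤ x j}

/-- The joint law of independent exponential valuations with parameters `rate j`. -/
def expLaw {m : ℕ} (rate : Fin m → ℝ) : Measure (Fin m → ℝ) :=
  Measure.pi fun j => expMeasure (rate j)

/-- The upper incomplete Gamma function `Γ(m, w)`, for positive integers `m` and `0 ≤ w`. -/
def incGamma (m : ℕ) (w : ℝ) : ℝ :=
  ∫ t in Set.Ioi w, t ^ (m - 1) * Real.exp (-t)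

/-- `g(m, w) = Γ(m + 1, w) - (m + 1) Γ(m, w)`. -/
def gFun (m : ℕ) (w : ℝ) : ℝ :=
  incGamma (m + 1) w - (m + 1) * incGamma m w

/-- The root of `g(m, ·)` in `[0, ∞)`. It is unique for `1 ≤ m`, so that the infimum below
is over a one-point set. -/
def gammaStar (m : ℕ) : ℝ :=
  sInf {w | 0 ≤ w ∧ gFun m w = 0}

/-- `G(m) = ∫_0^∞ max {0, g(m, w)} dw`. -/
def GFun (m : ℕ) : ℝ :=
  ∫ w in Set.Ioi (0 : ℝ), max 0 (gFun m w)

end OptimalSelling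

end

/-!
Restrict a mechanism to the ray through a direction `y`. As a function of `t`, the utility
`h t = u (t • y)` is nonnegative and convex, with the nondecreasing subgradient
`s t = ∑ j, a (t • y) j * y j ∈ [0, ∑ j, y j]`, and the payment is `t * s t - h t`: this is a
mechanism selling one good. Since `h t ≥ ∫₀ᵗ s`, exchanging the order of integration bounds the
revenue under a weight `ω` by `∫ s t * (t * ω t - ∫ₜ^∞ ω) dt`, and hence by `∑ j, y j` times the
integral of the positive part of the virtual value `t * ω t - ∫ₜ^∞ ω`.

In polar coordinates the law of the valuations has density `t ^ (m - 1) * exp (-c * t)` along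
each ray, up to a constant factor. The virtual value of this Gamma weight is, up to scaling,
`g(m, c * t)`, so the integral of its positive part is a multiple of `G(m)`, and on every ray the
revenue is at most `G(m) / m!` times the integral of `∑ j, x j`. Integrating over the directions
and using `E x_j = 1 / λ_j` gives the bound.
-/

namespace OptimalSelling

open Set Filter Topology

/-! ### The incomplete Gamma function and the functions `g` and `G` -/

lemma continuous_pow_mul_exp_neg (n : ℕ) :
    Continuous fun t : ℝ => t ^ n * Real.exp (-t) := by fun_prop

lemma integrableOn_pow_mul_exp_neg (n : ℕ) (w : ℝ) :
    IntegrableOn (fun t : ℝ => t ^ n * Real.exp (-t)) (Ioi w) := by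
  have hIoi : IntegrableOn (fun t : ℝ => t ^ n * Real.exp (-t)) (Ioi 0) := by
    refine (Real.GammaIntegral_convergent (s := n + 1) (by positivity)).congr_fun (fun t _ => ?_)
      measurableSet_Ioi
    simp [mul_comm]
  have hIcc : IntegrableOn (fun t : ℝ => t ^ n * Real.exp (-t)) (Icc w 0) :=
    (continuous_pow_mul_exp_neg n).continuousOn.integrableOn_Icc
  refine (hIcc.union hIoi).mono_set fun t ht => ?_
  rcases le_or_gt t 0 with h | h
  · exact Or.inl ⟨le_of_lt ht, h⟩
  · exact Or.inr h

lemma integral_pow_mul_exp_neg (n : ℕ) :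
    ∫ t in Ioi (0 : ℝ), t ^ n * Real.exp (-t) = n.factorial := by
  rw [← Real.Gamma_nat_eq_factorial, Real.Gamma_eq_integral (by positivity)]
  refine setIntegral_congr_fun measurableSet_Ioi fun t _ => ?_
  simp [mul_comm]

lemma incGamma_zero (m : ℕ) : incGamma m 0 = (m - 1).factorial :=
  integral_pow_mul_exp_neg _

lemma incGamma_eq_sub (m : ℕ) (w : ℝ) :
    incGamma m w = incGamma m 0 - ∫ t in (0 : ℝ)..w, t ^ (m - 1) * Real.exp (-t) := by
  rw [← intervalIntegral.integral_Ioi_sub_Ioi' (integrableOn_pow_mul_exp_neg (m - 1) 0)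
    (integrableOn_pow_mul_exp_neg (m - 1) w), incGamma, incGamma, sub_sub_cancel]

lemma hasDerivAt_incGamma (m : ℕ) (w : ℝ) :
    HasDerivAt (incGamma m) (-(w ^ (m - 1) * Real.exp (-w))) w := by
  have h := ((continuous_pow_mul_exp_neg (m - 1)).integral_hasStrictDerivAt 0 w).hasDerivAt
  exact (h.const_sub (incGamma m 0)).congr_of_eventuallyEq
    (Eventually.of_forall (incGamma_eq_sub m))

lemma incGamma_nonneg (m : ℕ) {w : ℝ} (hw : 0 ≤ w) : 0 ≤ incGamma m w :=
  setIntegral_nonneg measurableSet_Ioi fun t ht => by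
    have : 0 < t := hw.trans_lt ht
    positivity

lemma tendsto_incGamma (m : ℕ) : Tendsto (incGamma m) atTop (𝓝 0) := by
  have h := (intervalIntegral_tendsto_integral_Ioi 0
    (integrableOn_pow_mul_exp_neg (m - 1) 0) tendsto_id).const_sub (incGamma m 0)
  rw [← incGamma, sub_self] at h
  exact h.congr fun w => (incGamma_eq_sub m w).symm

lemma incGamma_succ (m : ℕ) (w : ℝ) :
    incGamma (m + 1) w = m * incGamma m w + w ^ m * Real.exp (-w) := by
  have hderiv : ∀ t : ℝ, HasDerivAt (fun t => -(t ^ m * Real.exp (-t)))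
      (t ^ m * Real.exp (-t) - m * (t ^ (m - 1) * Real.exp (-t))) t := fun t =>
    ((hasDerivAt_pow m t).mul (hasDerivAt_neg t).exp).neg.congr_deriv (by ring)
  have hint := integrableOn_pow_mul_exp_neg m w
  have hint' := (integrableOn_pow_mul_exp_neg (m - 1) w).const_mul (m : ℝ)
  have hparts := integral_Ioi_of_hasDerivAt_of_tendsto' (fun t _ => hderiv t) (hint.sub hint')
    (by simpa using (Real.tendsto_pow_mul_exp_neg_atTop_nhds_zero m).neg)
  rw [integral_sub hint hint', integral_const_mul] at hparts
  simp only [incGamma, add_tsub_cancel_right]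
  linarith

lemma tendsto_mul_incGamma {m : ℕ} (hm : 1 ≤ m) :
    Tendsto (fun w => w * incGamma m w) atTop (𝓝 0) := by
  refine squeeze_zero' ?_ ?_ (tendsto_incGamma (m + 1))
  · filter_upwards [eventually_ge_atTop 0] with w hw using mul_nonneg hw (incGamma_nonneg m hw)
  · filter_upwards [eventually_ge_atTop 0] with w hw
    rw [incGamma, ← integral_const_mul]
    refine setIntegral_mono_on ((integrableOn_pow_mul_exp_neg _ _).const_mul _)
      (integrableOn_pow_mul_exp_neg _ _) measurableSet_Ioi fun t ht => ?_
    have ht0 : 0 < t := hw.trans_lt ht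
    obtain ⟨k, rfl⟩ := Nat.exists_eq_add_of_le' hm
    simp only [add_tsub_cancel_right]
    rw [← mul_assoc, pow_succ']
    have := le_of_lt (mem_Ioi.1 ht)
    gcongr

lemma gFun_eq_sub (m : ℕ) (w : ℝ) :
    gFun m w = w ^ m * Real.exp (-w) - incGamma m w := by
  rw [gFun, incGamma_succ]
  ring

lemma hasDerivAt_gFun {m : ℕ} (hm : 1 ≤ m) (w : ℝ) :
    HasDerivAt (gFun m) (w ^ (m - 1) * Real.exp (-w) * (m + 1 - w)) w := by
  have h := ((hasDerivAt_pow m w).mul (hasDerivAt_neg w).exp).sub (hasDerivAt_incGamma m w)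
  refine (h.congr_deriv ?_).congr_of_eventuallyEq
    (Eventually.of_forall fun x => gFun_eq_sub m x)
  obtain ⟨k, rfl⟩ := Nat.exists_eq_add_of_le' hm
  simp only [add_tsub_cancel_right]
  push_cast
  ring

lemma continuous_gFun {m : ℕ} (hm : 1 ≤ m) : Continuous (gFun m) :=
  continuous_iff_continuousAt.2 fun w => (hasDerivAt_gFun hm w).continuousAt

lemma tendsto_gFun (m : ℕ) : Tendsto (gFun m) atTop (𝓝 0) := by
  have h := (Real.tendsto_pow_mul_exp_neg_atTop_nhds_zero m).sub (tendsto_incGamma m)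
  simp only [sub_zero] at h
  exact h.congr fun w => (gFun_eq_sub m w).symm

lemma gFun_zero_neg {m : ℕ} (hm : 1 ≤ m) : gFun m 0 < 0 := by
  rw [gFun_eq_sub, incGamma_zero, zero_pow (by lia), zero_mul, zero_sub, neg_lt_zero]
  positivity

lemma strictMonoOn_gFun {m : ℕ} (hm : 1 ≤ m) : StrictMonoOn (gFun m) (Icc 0 (m + 1)) := by
  refine strictMonoOn_of_deriv_pos (convex_Icc _ _) (continuous_gFun hm).continuousOn fun w hw => ?_
  rw [interior_Icc] at hw
  rw [(hasDerivAt_gFun hm w).deriv]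
  have hw0 := hw.1
  have hwm : 0 < m + 1 - w := sub_pos.2 hw.2
  positivity

lemma strictAntiOn_gFun {m : ℕ} (hm : 1 ≤ m) : StrictAntiOn (gFun m) (Ici (m + 1)) := by
  refine strictAntiOn_of_deriv_neg (convex_Ici _) (continuous_gFun hm).continuousOn fun w hw => ?_
  rw [interior_Ici] at hw
  rw [(hasDerivAt_gFun hm w).deriv]
  have hw0 : 0 < w := lt_trans (by positivity) (mem_Ioi.1 hw)
  exact mul_neg_of_pos_of_neg (by positivity) (sub_neg.2 hw)

lemma gFun_pos_of_add_one_le {m : ℕ} (hm : 1 ≤ m) {w : ℝ} (hw : m + 1 ≤ w) : 0 < gFun m w := by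
  have hanti := strictAntiOn_gFun hm
  have hmem : w + 1 ∈ Ici (m + 1 : ℝ) := hw.trans (by simp)
  have hnonneg : 0 ≤ gFun m (w + 1) := by
    refine le_of_tendsto (tendsto_gFun m) ?_
    filter_upwards [eventually_ge_atTop (w + 1)] with v hv
    exact hanti.antitoneOn hmem (hmem.trans hv) hv
  exact hnonneg.trans_lt (hanti hw hmem (by simp))

lemma exists_gFun_root {m : ℕ} (hm : 1 ≤ m) :
    ∃ γ : ℝ, 0 ≤ γ ∧ gFun m γ = 0 ∧ (∀ w, 0 ≤ w → w < γ → gFun m w < 0) ∧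
      ∀ w, γ < w → 0 < gFun m w := by
  obtain ⟨γ, hγ, hroot⟩ := intermediate_value_Icc (by positivity : (0 : ℝ) ≤ m + 1)
    (continuous_gFun hm).continuousOn ⟨(gFun_zero_neg hm).le, (gFun_pos_of_add_one_le hm le_rfl).le⟩
  have hmono := strictMonoOn_gFun hm
  refine ⟨γ, hγ.1, hroot, fun w hw hwγ => ?_, fun w hw => ?_⟩
  · exact hroot ▸ hmono ⟨hw, hwγ.le.trans hγ.2⟩ hγ hwγ
  · rcases le_total w (m + 1) with h | h
    · exact hroot ▸ hmono hγ ⟨hγ.1.trans hw.le, h⟩ hw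
    · exact gFun_pos_of_add_one_le hm h

lemma gFun_sign_gammaStar {m : ℕ} (hm : 1 ≤ m) :
    0 ≤ gammaStar m ∧ gFun m (gammaStar m) = 0 ∧
      (∀ w, 0 ≤ w → w < gammaStar m → gFun m w < 0) ∧ ∀ w, gammaStar m < w → 0 < gFun m w := by
  obtain ⟨γ, hγ, hroot, hneg, hpos⟩ := exists_gFun_root hm
  have hleast : IsLeast {w | 0 ≤ w ∧ gFun m w = 0} γ :=
    ⟨⟨hγ, hroot⟩, fun w hw => le_of_not_gt fun hwγ => (hneg w hw.1 hwγ).ne hw.2⟩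
  rw [gammaStar, hleast.csInf_eq]
  exact ⟨hγ, hroot, hneg, hpos⟩

lemma gammaStar_nonneg {m : ℕ} (hm : 1 ≤ m) : 0 ≤ gammaStar m :=
  (gFun_sign_gammaStar hm).1

lemma gFun_gammaStar {m : ℕ} (hm : 1 ≤ m) : gFun m (gammaStar m) = 0 :=
  (gFun_sign_gammaStar hm).2.1

lemma gFun_neg_of_lt_gammaStar {m : ℕ} (hm : 1 ≤ m) {w : ℝ} (hw : 0 ≤ w) (h : w < gammaStar m) :
    gFun m w < 0 :=
  (gFun_sign_gammaStar hm).2.2.1 w hw h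

lemma gFun_pos_of_gammaStar_lt {m : ℕ} (hm : 1 ≤ m) {w : ℝ} (h : gammaStar m < w) :
    0 < gFun m w :=
  (gFun_sign_gammaStar hm).2.2.2 w h

lemma eq_gammaStar_iff {m : ℕ} (hm : 1 ≤ m) (w : ℝ) :
    (0 ≤ w ∧ gFun m w = 0) ↔ w = gammaStar m := by
  constructor
  · rintro ⟨hw, hroot⟩
    rcases lt_trichotomy w (gammaStar m) with h | h | h
    · exact absurd hroot (gFun_neg_of_lt_gammaStar hm hw h).ne
    · exact h
    · exact absurd hroot (gFun_pos_of_gammaStar_lt hm h).ne'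
  · rintro rfl
    exact ⟨gammaStar_nonneg hm, gFun_gammaStar hm⟩

lemma hasDerivAt_neg_mul_incGamma {m : ℕ} (hm : 1 ≤ m) (w : ℝ) :
    HasDerivAt (fun w => -(w * incGamma m w)) (gFun m w) w := by
  refine ((hasDerivAt_id w).mul (hasDerivAt_incGamma m w)).neg.congr_deriv ?_
  rw [gFun_eq_sub]
  obtain ⟨k, rfl⟩ := Nat.exists_eq_add_of_le' hm
  simp only [add_tsub_cancel_right, id]
  ring

lemma integrableOn_gFun {m : ℕ} (hm : 1 ≤ m) : IntegrableOn (gFun m) (Ioi (gammaStar m)) :=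
  integrableOn_Ioi_deriv_of_nonneg' (fun w _ => hasDerivAt_neg_mul_incGamma hm w)
    (fun _ hw => (gFun_pos_of_gammaStar_lt hm hw).le)
    (by simpa using (tendsto_mul_incGamma hm).neg)

lemma integral_Ioi_gammaStar_gFun {m : ℕ} (hm : 1 ≤ m) :
    ∫ w in Ioi (gammaStar m), gFun m w = gammaStar m * incGamma m (gammaStar m) := by
  rw [integral_Ioi_of_hasDerivAt_of_tendsto' (fun w _ => hasDerivAt_neg_mul_incGamma hm w)
    (integrableOn_gFun hm) (by simpa using (tendsto_mul_incGamma hm).neg)]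
  ring

lemma integrableOn_max_gFun {m : ℕ} (hm : 1 ≤ m) :
    IntegrableOn (fun w => max 0 (gFun m w)) (Ioi 0) := by
  have hIcc : IntegrableOn (fun w => max 0 (gFun m w)) (Icc 0 (gammaStar m)) :=
    (continuous_const.max (continuous_gFun hm)).continuousOn.integrableOn_Icc
  have hIoi : IntegrableOn (fun w => max 0 (gFun m w)) (Ioi (gammaStar m)) :=
    (integrableOn_gFun hm).congr_fun (fun w hw =>
      (max_eq_right (gFun_pos_of_gammaStar_lt hm hw).le).symm) measurableSet_Ioi
  refine (hIcc.union hIoi).mono_set fun t ht => ?_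
  rcases le_or_gt t (gammaStar m) with h | h
  · exact Or.inl ⟨le_of_lt ht, h⟩
  · exact Or.inr h

lemma GFun_eq_integral_gFun {m : ℕ} (hm : 1 ≤ m) :
    GFun m = ∫ w in Ioi (gammaStar m), gFun m w := by
  have hzero : ∀ w ∈ Ioi 0 \ Ioi (gammaStar m), max 0 (gFun m w) = 0 := fun w hw => by
    refine max_eq_left ?_
    rcases (not_lt.1 (mt mem_Ioi.2 hw.2)).eq_or_lt with rfl | h
    · exact (gFun_gammaStar hm).le
    · exact (gFun_neg_of_lt_gammaStar hm (le_of_lt hw.1) h).le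
  rw [GFun, setIntegral_eq_of_subset_of_forall_sdiff_eq_zero measurableSet_Ioi
    (Ioi_subset_Ioi (gammaStar_nonneg hm)) hzero]
  exact setIntegral_congr_fun measurableSet_Ioi fun w hw =>
    max_eq_right (gFun_pos_of_gammaStar_lt hm hw).le

lemma GFun_eq_mul_incGamma {m : ℕ} (hm : 1 ≤ m) :
    GFun m = gammaStar m * incGamma m (gammaStar m) :=
  (GFun_eq_integral_gFun hm).trans (integral_Ioi_gammaStar_gFun hm)

lemma GFun_eq_pow_mul_exp {m : ℕ} (hm : 1 ≤ m) :
    GFun m = gammaStar m ^ (m + 1) * Real.exp (-gammaStar m) := by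
  have h := gFun_gammaStar hm
  rw [gFun_eq_sub, sub_eq_zero] at h
  rw [GFun_eq_mul_incGamma hm, ← h]
  ring

lemma GFun_nonneg (m : ℕ) : 0 ≤ GFun m :=
  setIntegral_nonneg measurableSet_Ioi fun _ _ => le_max_left _ _

/-! ### Gamma weights -/

lemma integral_Ioi_pow_mul_exp_neg_mul (n : ℕ) {c : ℝ} (hc : 0 < c) (w : ℝ) :
    ∫ t in Ioi w, t ^ n * Real.exp (-(c * t)) = (c ^ (n + 1))⁻¹ * incGamma (n + 1) (c * w) := by
  have h := integral_comp_mul_left_Ioi (fun t => t ^ n * Real.exp (-t)) w hc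
  simp only [mul_pow, mul_assoc, integral_const_mul, smul_eq_mul] at h
  rw [incGamma, add_tsub_cancel_right, pow_succ, mul_inv, mul_assoc, ← h,
    inv_mul_cancel_left₀ (by positivity)]

lemma integrableOn_Ioi_pow_mul_exp_neg_mul (n : ℕ) {c : ℝ} (hc : 0 < c) (w : ℝ) :
    IntegrableOn (fun t : ℝ => t ^ n * Real.exp (-(c * t))) (Ioi w) := by
  have h : IntegrableOn (fun t => (c ^ n)⁻¹ * ((c * t) ^ n * Real.exp (-(c * t)))) (Ioi w) :=
    ((integrableOn_Ioi_comp_mul_left_iff (fun t => t ^ n * Real.exp (-t)) w hc).2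
      (integrableOn_pow_mul_exp_neg n (c * w))).const_mul _
  refine h.congr_fun (fun t _ => ?_) measurableSet_Ioi
  simp only [mul_pow]
  field_simp

lemma lintegral_Ioi_pow_mul_exp_neg_mul (n : ℕ) {c w : ℝ} (hc : 0 < c) (hw : 0 ≤ w) :
    ∫⁻ t in Ioi w, ENNReal.ofReal (t ^ n * Real.exp (-(c * t))) =
      ENNReal.ofReal ((c ^ (n + 1))⁻¹ * incGamma (n + 1) (c * w)) := by
  rw [← integral_Ioi_pow_mul_exp_neg_mul n hc, ofReal_integral_eq_lintegral_ofReal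
    (integrableOn_Ioi_pow_mul_exp_neg_mul n hc w)]
  filter_upwards [ae_restrict_mem measurableSet_Ioi] with t (ht : w < t)
  have : 0 < t := hw.trans_lt ht
  simp only [Pi.zero_apply]
  positivity

lemma lintegral_pow_mul_exp_neg_mul_mul (n : ℕ) {c : ℝ} (hc : 0 < c) :
    ∫⁻ t in Ioi 0, ENNReal.ofReal (t ^ n * Real.exp (-(c * t))) * ENNReal.ofReal t =
      ENNReal.ofReal ((c ^ (n + 2))⁻¹ * (n + 1).factorial) := by
  have h := lintegral_Ioi_pow_mul_exp_neg_mul (n + 1) hc le_rfl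
  rw [mul_zero, incGamma_zero, add_tsub_cancel_right] at h
  rw [← h]
  refine setLIntegral_congr_fun measurableSet_Ioi fun t (ht : 0 < t) => ?_
  rw [← ENNReal.ofReal_mul (by positivity), pow_succ, mul_right_comm]

lemma lintegral_ofReal_gFun_comp_mul {m : ℕ} (hm : 1 ≤ m) {c : ℝ} (hc : 0 < c) :
    ∫⁻ t in Ioi 0, ENNReal.ofReal (gFun m (c * t)) = ENNReal.ofReal (c⁻¹ * GFun m) := by
  have hint : IntegrableOn (fun t => max 0 (gFun m (c * t))) (Ioi 0) :=
    (integrableOn_Ioi_comp_mul_left_iff (fun t => max 0 (gFun m t)) 0 hc).2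
      (by simpa using integrableOn_max_gFun hm)
  have hscale := integral_comp_mul_left_Ioi (fun t => max 0 (gFun m t)) 0 hc
  rw [mul_zero, smul_eq_mul] at hscale
  rw [GFun, ← hscale, ofReal_integral_eq_lintegral_ofReal hint
    (ae_of_all _ fun t => le_max_left _ _)]
  simp only [ENNReal.ofReal_max, ENNReal.ofReal_zero, zero_le, max_eq_right]

lemma gammaWeight_mul_sub_lintegral (n : ℕ) {c t : ℝ} (hc : 0 < c) (ht : 0 < t) :
    ENNReal.ofReal (t ^ n * Real.exp (-(c * t))) * ENNReal.ofReal t -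
        ∫⁻ x in Ioi t, ENNReal.ofReal (x ^ n * Real.exp (-(c * x))) =
      ENNReal.ofReal ((c ^ (n + 1))⁻¹) * ENNReal.ofReal (gFun (n + 1) (c * t)) := by
  have hΓ := incGamma_nonneg (n + 1) (mul_pos hc ht).le
  rw [lintegral_Ioi_pow_mul_exp_neg_mul n hc ht.le, ← ENNReal.ofReal_mul (by positivity),
    ← ENNReal.ofReal_sub _ (by positivity), ← ENNReal.ofReal_mul (by positivity), gFun_eq_sub]
  congr 1
  field_simp
  ring

lemma lintegral_gammaWeight_mul_sub_lintegral (n : ℕ) {c : ℝ} (hc : 0 < c) :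
    ∫⁻ t in Ioi 0, (ENNReal.ofReal (t ^ n * Real.exp (-(c * t))) * ENNReal.ofReal t -
        ∫⁻ x in Ioi t, ENNReal.ofReal (x ^ n * Real.exp (-(c * x)))) =
      ENNReal.ofReal ((c ^ (n + 2))⁻¹ * GFun (n + 1)) := by
  rw [setLIntegral_congr_fun measurableSet_Ioi fun t ht => gammaWeight_mul_sub_lintegral n hc ht,
    lintegral_const_mul' _ _ ENNReal.ofReal_ne_top, lintegral_ofReal_gFun_comp_mul (by lia) hc,
    ← ENNReal.ofReal_mul (by positivity), ← mul_assoc, ← mul_inv, ← pow_succ]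

/-! ### Single-good mechanisms along a ray -/

/-- The slope `s` is a selection of subgradients of `h` on `S`: each line through `(t, h t)` with
slope `s t` supports `h` from below. -/
def IsSubgradientOn (h s : ℝ → ℝ) (S : Set ℝ) : Prop :=
  ∀ t ∈ S, ∀ t' ∈ S, h t + s t * (t' - t) ≤ h t'

namespace IsSubgradientOn

variable {h s : ℝ → ℝ} {S : Set ℝ}

lemma convexOn (hs : IsSubgradientOn h s S) (hS : Convex ℝ S) : ConvexOn ℝ S h := by
  refine ⟨hS, fun x hx y hy a b ha hb hab => ?_⟩
  have hw := hS hx hy ha hb hab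
  have hx' := mul_le_mul_of_nonneg_left (hs _ hw x hx) ha
  have hy' := mul_le_mul_of_nonneg_left (hs _ hw y hy) hb
  obtain rfl : b = 1 - a := by linarith
  simp only [smul_eq_mul] at *
  linarith

lemma monotoneOn (hs : IsSubgradientOn h s S) : MonotoneOn s S := by
  intro x hx y hy hxy
  rcases hxy.eq_or_lt with rfl | hlt
  · exact le_rfl
  have hxy' := hs x hx y hy
  have hyx' := hs y hy x hx
  refine le_of_mul_le_mul_right ?_ (sub_pos.2 hlt)
  linarith

lemma le_rightDeriv (hs : IsSubgradientOn h s S) (hS : Convex ℝ S) {t : ℝ}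
    (ht : t ∈ interior S) : s t ≤ derivWithin h (Ioi t) t := by
  have hd := (hs.convexOn hS).hasDerivWithinAt_rightDeriv_of_mem_interior ht
  rw [hasDerivWithinAt_iff_tendsto_slope' (by simp)] at hd
  refine ge_of_tendsto hd ?_
  filter_upwards [self_mem_nhdsWithin, nhdsWithin_le_nhds (mem_interior_iff_mem_nhds.1 ht)]
    with t' (ht' : t < t') htS
  rw [slope_def_field, le_div_iff₀ (sub_pos.2 ht')]
  linarith [hs t (interior_subset ht) t' htS]

lemma integral_le (hs : IsSubgradientOn h s S) (hS : Convex ℝ S) (hSo : IsOpen S) {a b : ℝ}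
    (ha : a ∈ S) (hb : b ∈ S) (hab : a ≤ b) : ∫ t in a..b, s t ≤ h b - h a := by
  have hconv := hs.convexOn hS
  have hsub : Icc a b ⊆ S := hS.ordConnected.out ha hb
  have hint : ∀ t ∈ Ioo a b, t ∈ interior S := fun t ht =>
    hSo.interior_eq.symm ▸ hsub (Ioo_subset_Icc_self ht)
  exact intervalIntegral.integral_le_sub_of_hasDeriv_right_of_le hab
    ((hconv.continuousOn hSo).mono hsub)
    (fun t ht => hconv.hasDerivWithinAt_rightDeriv_of_mem_interior (hint t ht))
    ((hs.monotoneOn.mono hsub).integrableOn_isCompact isCompact_Icc)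
    fun t ht => hs.le_rightDeriv hS (hint t ht)

end IsSubgradientOn

lemma isSubgradientOn_rightDeriv {h : ℝ → ℝ} {S : Set ℝ} (hh : ConvexOn ℝ S h) (hS : IsOpen S) :
    IsSubgradientOn h (fun t => derivWithin h (Ioi t) t) S := by
  intro t ht t' ht'
  have hti : t ∈ interior S := by rwa [hS.interior_eq]
  rcases lt_trichotomy t t' with hlt | rfl | hlt
  · have hslope := hh.rightDeriv_le_slope_of_mem_interior hti ht' hlt
    rw [slope_def_field, le_div_iff₀ (sub_pos.2 hlt)] at hslope
    linarith
  · simp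
  · have hslope := (hh.slope_le_leftDeriv_of_mem_interior ht' hti hlt).trans
      (hh.leftDeriv_le_rightDeriv_of_mem_interior hti)
    rw [slope_def_field, div_le_iff₀ (sub_pos.2 hlt)] at hslope
    linarith

/-- An individually rational and incentive compatible mechanism for a single good, seen through
its utility `h` and its allocation `s`, which is at most `C`; the payment is `t * s t - h t`.
The restriction of a mechanism for several goods to a ray has this form, the good being the bundle
that grows along the ray. The allocation is only bounded almost everywhere, so that the right
derivative of a feasible utility function qualifies. -/
structure IsRayUtility (C : ℝ) (h s : ℝ → ℝ) : Prop where
  nonneg : ∀ t, 0 < t → 0 ≤ h t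
  slope_mem : ∀ᵐ t ∂(volume.restrict (Ioi (0 : ℝ))), s t ∈ Icc 0 C
  subgradient : IsSubgradientOn h s (Ioi 0)

lemma lintegral_mul_lintegral_Ioc {μ ν : Measure ℝ} [SFinite μ] [SFinite ν] (a : ℝ)
    {f σ : ℝ → ENNReal} (hf : AEMeasurable f (μ.restrict (Ioi a)))
    (hσ : AEMeasurable σ (ν.restrict (Ioi a))) :
    ∫⁻ t in Ioi a, f t * ∫⁻ x in Ioc a t, σ x ∂ν ∂μ =
      ∫⁻ x in Ioi a, (∫⁻ t in Ici x, f t ∂μ) * σ x ∂ν := by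
  set k : ℝ → ℝ → ENNReal := fun t x => {q : ℝ × ℝ | q.2 ≤ q.1}.indicator
    (fun q => f q.1 * σ q.2) (t, x)
  have hk : AEMeasurable (Function.uncurry k)
      ((μ.restrict (Ioi a)).prod (ν.restrict (Ioi a))) :=
    (hf.comp_fst.mul hσ.comp_snd).indicator (measurableSet_le measurable_snd measurable_fst)
  have hleft : ∀ t, f t * ∫⁻ x in Ioc a t, σ x ∂ν = ∫⁻ x in Ioi a, k t x ∂ν := fun t => by
    rw [show k t = (Iic t).indicator fun x => f t * σ x from rfl,
      lintegral_indicator measurableSet_Iic, Measure.restrict_restrict measurableSet_Iic,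
      inter_comm, Ioi_inter_Iic, lintegral_const_mul'' _ (hσ.mono_set Ioc_subset_Ioi_self)]
  have hright : ∀ x ∈ Ioi a, ∫⁻ t in Ioi a, k t x ∂μ = (∫⁻ t in Ici x, f t ∂μ) * σ x :=
    fun x hx => by
      have hIci : Ici x ⊆ Ioi a := Ici_subset_Ioi.2 hx
      rw [show (fun t => k t x) = (Ici x).indicator fun t => f t * σ x from rfl,
        lintegral_indicator measurableSet_Ici, Measure.restrict_restrict measurableSet_Ici,
        inter_eq_left.2 hIci, lintegral_mul_const'' _ (hf.mono_set hIci)]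
  rw [lintegral_congr hleft, lintegral_lintegral_swap hk]
  exact setLIntegral_congr_fun measurableSet_Ioi hright

namespace IsRayUtility

variable {C : ℝ} {h s : ℝ → ℝ}

lemma aemeasurable_slope (hu : IsRayUtility C h s) :
    AEMeasurable (fun t => ENNReal.ofReal (s t)) (volume.restrict (Ioi 0)) :=
  (aemeasurable_restrict_of_monotoneOn measurableSet_Ioi hu.subgradient.monotoneOn).ennreal_ofReal

lemma slope_nonneg (hu : IsRayUtility C h s) {t : ℝ} (ht : 0 < t) : 0 ≤ s t := by
  have hmem : ∀ᵐ x ∂(volume.restrict (Ioo 0 t)), s x ∈ Icc 0 C :=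
    ae_restrict_of_ae_restrict_of_subset Ioo_subset_Ioi_self hu.slope_mem
  have : (ae (volume.restrict (Ioo 0 t))).NeBot := by
    rw [ae_neBot, Ne, Measure.restrict_eq_zero]
    simp [ht]
  obtain ⟨x, hx, hxt⟩ := (hmem.and (ae_restrict_mem measurableSet_Ioo)).exists
  exact hx.1.trans (hu.subgradient.monotoneOn hxt.1 ht hxt.2.le)

lemma lintegral_slope_le (hu : IsRayUtility C h s) {t : ℝ} (ht : 0 < t) :
    ∫⁻ x in Ioc 0 t, ENNReal.ofReal (s x) ≤ ENNReal.ofReal (h t) := by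
  have hle : ∀ ε > 0, ε ≤ t →
      ∫⁻ x in Ioc ε t, ENNReal.ofReal (s x) ≤ ENNReal.ofReal (h t) := fun ε hε hεt => by
    have hsub : Icc ε t ⊆ Ioi 0 := fun x hx => hε.trans_le hx.1
    have hint : IntegrableOn s (Icc ε t) :=
      (hu.subgradient.monotoneOn.mono hsub).integrableOn_isCompact isCompact_Icc
    rw [← ofReal_integral_eq_lintegral_ofReal (hint.mono_set Ioc_subset_Icc_self)
      ((ae_restrict_mem measurableSet_Ioc).mono fun x hx => hu.slope_nonneg (hε.trans hx.1)),
      ← intervalIntegral.integral_of_le hεt]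
    have := hu.subgradient.integral_le (convex_Ioi 0) isOpen_Ioi hε ht hεt
    exact ENNReal.ofReal_le_ofReal (by linarith [hu.nonneg ε hε])
  have hcover : AECover (volume.restrict (Ioc 0 t)) (𝓝[>] 0) fun ε : ℝ => Ioc ε t :=
    aecover_Ioc_of_Ioc (tendsto_id.mono_left nhdsWithin_le_nhds) tendsto_const_nhds
  refine le_of_tendsto (hcover.lintegral_tendsto_of_countably_generated
    (hu.aemeasurable_slope.mono_set Ioc_subset_Ioi_self)) ?_
  filter_upwards [Ioc_mem_nhdsGT ht] with ε hε
  rw [Measure.restrict_restrict_of_subset (Ioc_subset_Ioc_left hε.1.le)]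
  exact hle ε hε.1 hε.2

lemma payment_add_lintegral_slope_le (hu : IsRayUtility C h s) {t : ℝ} (ht : 0 < t) :
    ENNReal.ofReal (t * s t - h t) + ∫⁻ x in Ioc 0 t, ENNReal.ofReal (s x) ≤
      ENNReal.ofReal t * ENNReal.ofReal (s t) := by
  rw [← ENNReal.ofReal_mul ht.le]
  rcases le_total 0 (t * s t - h t) with hpay | hpay
  · calc _ ≤ ENNReal.ofReal (t * s t - h t) + ENNReal.ofReal (h t) := by
          gcongr
          exact hu.lintegral_slope_le ht
      _ = ENNReal.ofReal (t * s t) := by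
          rw [← ENNReal.ofReal_add hpay (hu.nonneg t ht), sub_add_cancel]
  · have hmono : ∀ x ∈ Ioc 0 t, ENNReal.ofReal (s x) ≤ ENNReal.ofReal (s t) := fun x hx =>
      ENNReal.ofReal_le_ofReal (hu.subgradient.monotoneOn hx.1 ht hx.2)
    rw [ENNReal.ofReal_of_nonpos hpay, zero_add]
    refine (setLIntegral_mono measurable_const hmono).trans_eq ?_
    rw [setLIntegral_const, Real.volume_Ioc, sub_zero, mul_comm, ENNReal.ofReal_mul ht.le]

lemma lintegral_payment_add_lintegral_le (hu : IsRayUtility C h s) {ω : ℝ → ENNReal}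
    (hω : Measurable ω) :
    (∫⁻ t in Ioi 0, ω t * ENNReal.ofReal (t * s t - h t)) +
        ∫⁻ t in Ioi 0, (∫⁻ x in Ioi t, ω x) * ENNReal.ofReal (s t) ≤
      ∫⁻ t in Ioi 0, ω t * ENNReal.ofReal t * ENNReal.ofReal (s t) := by
  have hfubini := lintegral_mul_lintegral_Ioc (μ := volume) 0 hω.aemeasurable hu.aemeasurable_slope
  simp only [← restrict_Ioi_eq_restrict_Ici] at hfubini
  rw [← hfubini]
  refine (le_lintegral_add _ _).trans (setLIntegral_mono' measurableSet_Ioi fun t ht => ?_)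
  rw [← mul_add, mul_assoc]
  gcongr
  exact hu.payment_add_lintegral_slope_le ht

/-- With truncated subtraction, the integrand on the right is the positive part of the virtual
value of the weight `ω`. -/
theorem lintegral_payment_le (hu : IsRayUtility C h s) {ω : ℝ → ENNReal} (hω : Measurable ω)
    (hω_fin : ∫⁻ t in Ioi 0, ω t * ENNReal.ofReal t ≠ ⊤) :
    ∫⁻ t in Ioi 0, ω t * ENNReal.ofReal (t * s t - h t) ≤
      ENNReal.ofReal C * ∫⁻ t in Ioi 0, (ω t * ENNReal.ofReal t - ∫⁻ x in Ioi t, ω x) := by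
  set σ : ℝ → ENNReal := fun t => ENNReal.ofReal (s t)
  set W : ℝ → ENNReal := fun t => ∫⁻ x in Ioi t, ω x
  have hσC : ∀ᵐ t ∂(volume.restrict (Ioi (0 : ℝ))), σ t ≤ ENNReal.ofReal C :=
    hu.slope_mem.mono fun t ht => ENNReal.ofReal_le_ofReal ht.2
  have hW : Measurable W := Antitone.measurable fun t t' htt' =>
    lintegral_mono_set (Ioi_subset_Ioi htt')
  have hpay : (∫⁻ t in Ioi 0, ω t * ENNReal.ofReal (t * s t - h t)) + ∫⁻ t in Ioi 0, W t * σ t ≤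
      ∫⁻ t in Ioi 0, ω t * ENNReal.ofReal t * σ t :=
    hu.lintegral_payment_add_lintegral_le hω
  have htotal : ∫⁻ t in Ioi 0, ω t * ENNReal.ofReal t * σ t ≠ ⊤ := by
    refine ne_top_of_le_ne_top (ENNReal.mul_ne_top hω_fin (ENNReal.ofReal_ne_top (r := C))) ?_
    rw [← lintegral_mul_const _ (by fun_prop)]
    exact lintegral_mono_ae (hσC.mono fun t ht => mul_le_mul_right ht _)
  have hvirtual : ∫⁻ t in Ioi 0, ω t * ENNReal.ofReal t * σ t ≤
      (ENNReal.ofReal C * ∫⁻ t in Ioi 0, (ω t * ENNReal.ofReal t - W t)) +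
        ∫⁻ t in Ioi 0, W t * σ t := by
    rw [← lintegral_const_mul _ (by fun_prop), ← lintegral_add_left (by fun_prop)]
    refine lintegral_mono_ae (hσC.mono fun t ht => ?_)
    calc ω t * ENNReal.ofReal t * σ t
        ≤ ((ω t * ENNReal.ofReal t - W t) + W t) * σ t := by gcongr; exact le_tsub_add
      _ ≤ ENNReal.ofReal C * (ω t * ENNReal.ofReal t - W t) + W t * σ t := by
        rw [add_mul, mul_comm (ENNReal.ofReal C)]
        gcongr
  have hfin : ∫⁻ t in Ioi 0, W t * σ t ≠ ⊤ := ne_top_of_le_ne_top htotal (le_add_self.trans hpay)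
  exact (ENNReal.add_le_add_iff_right hfin).1 (hpay.trans hvirtual)

theorem lintegral_gammaWeight_payment_le (hu : IsRayUtility C h s) (n : ℕ) {c : ℝ} (hc : 0 < c) :
    ∫⁻ t in Ioi 0, ENNReal.ofReal (t ^ n * Real.exp (-(c * t))) * ENNReal.ofReal (t * s t - h t) ≤
      ENNReal.ofReal (GFun (n + 1) / (n + 1).factorial) *
        ∫⁻ t in Ioi 0, ENNReal.ofReal (t ^ n * Real.exp (-(c * t))) * ENNReal.ofReal (t * C) := by
  have hmoment := lintegral_pow_mul_exp_neg_mul_mul n hc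
  have hmomentC :
      ∫⁻ t in Ioi 0, ENNReal.ofReal (t ^ n * Real.exp (-(c * t))) * ENNReal.ofReal (t * C) =
        ENNReal.ofReal ((c ^ (n + 2))⁻¹ * (n + 1).factorial) * ENNReal.ofReal C := by
    rw [← hmoment, ← lintegral_mul_const _ (by fun_prop)]
    refine setLIntegral_congr_fun measurableSet_Ioi fun t (ht : 0 < t) => ?_
    rw [ENNReal.ofReal_mul ht.le, mul_assoc]
  refine (hu.lintegral_payment_le (by fun_prop) (hmoment ▸ ENNReal.ofReal_ne_top)).trans_eq ?_
  rw [lintegral_gammaWeight_mul_sub_lintegral n hc, hmomentC, ← mul_assoc,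
    ← ENNReal.ofReal_mul (div_nonneg (GFun_nonneg _) (by positivity)), mul_comm]
  congr 2
  field_simp

end IsRayUtility

/-! ### Polar coordinates -/

section Polar

variable {E : Type*} [NormedAddCommGroup E] [NormedSpace ℝ E] [Nontrivial E]
  [FiniteDimensional ℝ E] [MeasurableSpace E] [BorelSpace E] (μ : Measure E) [μ.IsAddHaarMeasure]

lemma measurePreserving_smul_sphere :
    MeasurePreserving (fun q : Metric.sphere (0 : E) 1 × Ioi (0 : ℝ) => (q.2 : ℝ) • (q.1 : E))
      (μ.toSphere.prod (Measure.volumeIoiPow (Module.finrank ℝ E - 1))) μ := by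
  have hsub := measurePreserving_subtype_coe (μa := μ) (measurableSet_singleton (0 : E)).compl
  rw [restrict_compl_singleton] at hsub
  exact hsub.comp (μ.measurePreserving_homeomorphUnitSphereProd.symm
    (homeomorphUnitSphereProd E).toMeasurableEquiv)

lemma lintegral_volumeIoiPow (n : ℕ) {f : ℝ → ENNReal} (hf : Measurable f) :
    ∫⁻ r : Ioi (0 : ℝ), f r ∂(Measure.volumeIoiPow n) =
      ∫⁻ r in Ioi (0 : ℝ), ENNReal.ofReal (r ^ n) * f r := by
  rw [Measure.volumeIoiPow, lintegral_withDensity_eq_lintegral_mul _ (by fun_prop) (by fun_prop)]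
  exact lintegral_subtype_comap measurableSet_Ioi fun r => ENNReal.ofReal (r ^ n) * f r

lemma ae_volumeIoiPow_iff (n : ℕ) {p : ℝ → Prop} :
    (∀ᵐ r : Ioi (0 : ℝ) ∂(Measure.volumeIoiPow n), p r) ↔
      ∀ᵐ r ∂(volume.restrict (Ioi (0 : ℝ))), p r := by
  rw [Measure.volumeIoiPow, ae_withDensity_iff (by fun_prop), ← map_comap_subtype_coe
    measurableSet_Ioi, (MeasurableEmbedding.subtype_coe measurableSet_Ioi).ae_map_iff]
  refine eventually_congr (ae_of_all _ fun r => ?_)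
  have hr : 0 < (r : ℝ) ^ n := pow_pos r.2 n
  simp [hr]

lemma lintegral_eq_lintegral_sphere {f : E → ENNReal} (hf : Measurable f) :
    ∫⁻ x, f x ∂μ = ∫⁻ y : Metric.sphere (0 : E) 1, (∫⁻ r in Ioi (0 : ℝ),
      ENNReal.ofReal (r ^ (Module.finrank ℝ E - 1)) * f (r • (y : E))) ∂μ.toSphere := by
  rw [← (measurePreserving_smul_sphere μ).lintegral_comp hf, lintegral_prod _ (by fun_prop)]
  exact lintegral_congr fun y => lintegral_volumeIoiPow _ (f := fun r => f (r • (y : E)))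
    (by fun_prop)

lemma ae_ae_smul_sphere {p : E → Prop} (hp : ∀ᵐ x ∂μ, p x) :
    ∀ᵐ y : Metric.sphere (0 : E) 1 ∂μ.toSphere,
      ∀ᵐ r ∂(volume.restrict (Ioi (0 : ℝ))), p (r • (y : E)) := by
  have hprod := (measurePreserving_smul_sphere μ).quasiMeasurePreserving.ae hp
  filter_upwards [Measure.ae_ae_of_ae_prod hprod] with y hy
  exact (ae_volumeIoiPow_iff _ (p := fun r => p (r • (y : E)))).1 hy

lemma lintegral_le_lintegral_of_sphere {f g : E → ENNReal} (hg : Measurable g)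
    (h : ∀ᵐ y : Metric.sphere (0 : E) 1 ∂μ.toSphere,
      ∫⁻ r in Ioi (0 : ℝ), ENNReal.ofReal (r ^ (Module.finrank ℝ E - 1)) * f (r • (y : E)) ≤
        ∫⁻ r in Ioi (0 : ℝ), ENNReal.ofReal (r ^ (Module.finrank ℝ E - 1)) * g (r • (y : E))) :
    ∫⁻ x, f x ∂μ ≤ ∫⁻ x, g x ∂μ := by
  obtain ⟨f', hf', hle, heq⟩ := exists_measurable_le_lintegral_eq (μ := μ) f
  rw [heq, lintegral_eq_lintegral_sphere μ hf', lintegral_eq_lintegral_sphere μ hg]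
  refine lintegral_mono_ae (h.mono fun y hy => le_trans (lintegral_mono fun r => ?_) hy)
  gcongr
  exact hle _

end Polar

/-! ### Exponential valuations -/

lemma pi_withDensity_ofReal {ι : Type*} [Fintype ι] {f : ι → ℝ → ℝ}
    (h0 : ∀ i x, 0 ≤ f i x) (hi : ∀ i, Integrable (f i)) :
    Measure.pi (fun i => volume.withDensity fun x => ENNReal.ofReal (f i x)) =
      volume.withDensity fun x : ι → ℝ => ENNReal.ofReal (∏ i, f i (x i)) := by
  refine Measure.pi_eq fun s hs => ?_
  rw [withDensity_apply _ (MeasurableSet.univ_pi hs), volume_pi, Measure.restrict_pi_pi]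
  rw [← ofReal_integral_eq_lintegral_ofReal
    (Integrable.fintype_prod fun i => (hi i).restrict)
    (ae_of_all _ fun x => Finset.prod_nonneg fun i _ => h0 i _),
    integral_fintype_prod_eq_prod, ENNReal.ofReal_prod_of_nonneg fun i _ =>
      integral_nonneg fun x => h0 i x]
  refine Finset.prod_congr rfl fun i _ => ?_
  rw [withDensity_apply _ (hs i), ofReal_integral_eq_lintegral_ofReal (hi i).restrict
    (ae_of_all _ (h0 i))]

lemma integrable_exponentialPDFReal {r : ℝ} (hr : 0 < r) :
    Integrable (exponentialPDFReal r) := by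
  refine ⟨(measurable_exponentialPDFReal r).aestronglyMeasurable, ?_⟩
  rw [hasFiniteIntegral_iff_ofReal (ae_of_all _ (exponentialPDFReal_nonneg hr))]
  exact (lintegral_exponentialPDF_eq_one hr).trans_lt ENNReal.one_lt_top

/-- The joint density of independent exponential valuations with parameters `rate j`, written
without a product over the goods so that its restriction to a ray is visible. -/
noncomputable def expDensity {m : ℕ} (rate : Fin m → ℝ) : (Fin m → ℝ) → ENNReal :=
  (orthant m).indicator fun x =>
    ENNReal.ofReal ((∏ j, rate j) * Real.exp (-∑ j, rate j * x j))

lemma measurableSet_orthant (m : ℕ) : MeasurableSet (orthant m) :=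
  measurableSet_Ici (a := (0 : Fin m → ℝ))

lemma smul_mem_orthant_iff {m : ℕ} {x : Fin m → ℝ} {t : ℝ} (ht : 0 < t) :
    t • x ∈ orthant m ↔ x ∈ orthant m := by
  simp [orthant, ht]

lemma ofReal_prod_exponentialPDFReal {m : ℕ} (rate x : Fin m → ℝ) :
    ENNReal.ofReal (∏ j, exponentialPDFReal (rate j) (x j)) = expDensity rate x := by
  have hpdf : ∀ r y : ℝ,
      exponentialPDFReal r y = if 0 ≤ y then r * Real.exp (-(r * y)) else 0 := fun r y => by
    simp [exponentialPDFReal, gammaPDFReal]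
  by_cases hx : x ∈ orthant m
  · rw [expDensity, indicator_of_mem hx, ← Finset.sum_neg_distrib, Real.exp_sum,
      ← Finset.prod_mul_distrib]
    congr 1
    exact Finset.prod_congr rfl fun j _ => by rw [hpdf, if_pos (hx j)]
  · obtain ⟨j, hj⟩ := not_forall.1 hx
    rw [expDensity, indicator_of_notMem hx,
      Finset.prod_eq_zero (Finset.mem_univ j) (by rw [hpdf, if_neg hj]), ENNReal.ofReal_zero]

lemma measurable_expDensity {m : ℕ} (rate : Fin m → ℝ) : Measurable (expDensity rate) :=
  Measurable.indicator (by fun_prop) (measurableSet_orthant m)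

lemma expLaw_eq_withDensity {m : ℕ} {rate : Fin m → ℝ} (hr : ∀ j, 0 < rate j) :
    expLaw rate = volume.withDensity (expDensity rate) := by
  rw [← funext (ofReal_prod_exponentialPDFReal rate)]
  exact pi_withDensity_ofReal (fun j => exponentialPDFReal_nonneg (hr j))
    fun j => integrable_exponentialPDFReal (hr j)

lemma lintegral_expLaw {m : ℕ} {rate : Fin m → ℝ} (hr : ∀ j, 0 < rate j)
    (f : (Fin m → ℝ) → ENNReal) :
    ∫⁻ x, f x ∂(expLaw rate) = ∫⁻ x, expDensity rate x * f x := by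
  have hfin : ∀ x, expDensity rate x < ⊤ := fun x => by
    rw [← ofReal_prod_exponentialPDFReal]
    exact ENNReal.ofReal_lt_top
  rw [expLaw_eq_withDensity hr, lintegral_withDensity_eq_lintegral_mul_non_measurable _
    (measurable_expDensity rate) (ae_of_all _ hfin)]
  rfl

lemma lintegral_ray_expDensity {m : ℕ} {rate : Fin m → ℝ} (hr : ∀ j, 0 < rate j) (n : ℕ)
    {y : Fin m → ℝ} (hy : y ∈ orthant m) (F : ℝ → ENNReal) :
    ∫⁻ t in Ioi (0 : ℝ), ENNReal.ofReal (t ^ n) * (expDensity rate (t • y) * F t) =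
      ENNReal.ofReal (∏ j, rate j) * ∫⁻ t in Ioi (0 : ℝ),
        ENNReal.ofReal (t ^ n * Real.exp (-((∑ j, rate j * y j) * t))) * F t := by
  have hrate : 0 ≤ ∏ j, rate j := Finset.prod_nonneg fun j _ => (hr j).le
  rw [← lintegral_const_mul' _ _ ENNReal.ofReal_ne_top]
  refine setLIntegral_congr_fun measurableSet_Ioi fun t (ht : 0 < t) => ?_
  have hsum : ∑ j, rate j * (t • y) j = (∑ j, rate j * y j) * t := by
    simp only [Pi.smul_apply, smul_eq_mul, Finset.sum_mul]
    exact Finset.sum_congr rfl fun j _ => by ring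
  rw [expDensity, indicator_of_mem ((smul_mem_orthant_iff ht).2 hy), hsum, ← mul_assoc, ← mul_assoc,
    ← ENNReal.ofReal_mul (by positivity), ← ENNReal.ofReal_mul hrate, mul_left_comm]

lemma lintegral_ofReal_expMeasure {r : ℝ} (hr : 0 < r) :
    ∫⁻ x, ENNReal.ofReal x ∂(expMeasure r) = ENNReal.ofReal (1 / r) := by
  have hpdf : ∀ x, exponentialPDF r x * ENNReal.ofReal x =
      ENNReal.ofReal (1 / r) * gammaPDF 2 r x := fun x => by
    rcases lt_or_ge x 0 with hx | hx
    · rw [exponentialPDF_of_neg hx, gammaPDF_of_neg hx, zero_mul, mul_zero]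
    · rw [exponentialPDF_of_nonneg hx, gammaPDF_of_nonneg hx,
        ← ENNReal.ofReal_mul (by positivity), ← ENNReal.ofReal_mul (by positivity)]
      congr 1
      norm_num [Real.Gamma_two]
      field_simp
  calc ∫⁻ x, ENNReal.ofReal x ∂(expMeasure r)
      = ∫⁻ x, exponentialPDF r x * ENNReal.ofReal x :=
        lintegral_withDensity_eq_lintegral_mul _
          (measurable_exponentialPDFReal r).ennreal_ofReal ENNReal.measurable_ofReal
    _ = ENNReal.ofReal (1 / r) := by
        rw [lintegral_congr hpdf, lintegral_const_mul' _ _ ENNReal.ofReal_ne_top,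
          lintegral_gammaPDF_eq_one two_pos hr, mul_one]

lemma lintegral_sum_expLaw {m : ℕ} {rate : Fin m → ℝ} (hr : ∀ j, 0 < rate j) :
    ∫⁻ x, ∑ j, ENNReal.ofReal (x j) ∂(expLaw rate) = ENNReal.ofReal (∑ j, 1 / rate j) := by
  have := fun j => isProbabilityMeasure_expMeasure (hr j)
  rw [lintegral_finsetSum _ (fun j _ => by fun_prop),
    ENNReal.ofReal_sum_of_nonneg fun j _ => (one_div_pos.2 (hr j)).le]
  refine Finset.sum_congr rfl fun j _ => ?_
  rw [← lintegral_ofReal_expMeasure (hr j)]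
  exact (measurePreserving_eval (fun j => expMeasure (rate j)) j).lintegral_comp
    ENNReal.measurable_ofReal

lemma sum_mul_pos_of_mem_orthant {m : ℕ} {rate : Fin m → ℝ} (hr : ∀ j, 0 < rate j)
    {y : Fin m → ℝ} (hy : y ∈ orthant m) (hy0 : y ≠ 0) : 0 < ∑ j, rate j * y j := by
  obtain ⟨j, hj⟩ := Function.ne_iff.1 hy0
  exact Finset.sum_pos' (fun i _ => mul_nonneg (hr i).le (hy i))
    ⟨j, Finset.mem_univ j, mul_pos (hr j) ((hy j).lt_of_ne' hj)⟩

lemma sum_ofReal_smul {m : ℕ} {y : Fin m → ℝ} (hy : y ∈ orthant m) {t : ℝ} (ht : 0 < t) :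
    ∑ j, ENNReal.ofReal ((t • y) j) = ENNReal.ofReal (t * ∑ j, y j) := by
  rw [Finset.mul_sum, ENNReal.ofReal_sum_of_nonneg fun j _ => mul_nonneg ht.le (hy j)]
  rfl

lemma lintegral_ray_payment_le {n : ℕ} {rate : Fin (n + 1) → ℝ} (hr : ∀ j, 0 < rate j)
    {p : (Fin (n + 1) → ℝ) → ℝ} {y : Fin (n + 1) → ℝ} (hy : y ∈ orthant (n + 1)) (hy0 : y ≠ 0)
    {h s : ℝ → ℝ} (hu : IsRayUtility (∑ j, y j) h s)
    (hp : ∀ᵐ t ∂(volume.restrict (Ioi (0 : ℝ))), p (t • y) = t * s t - h t) :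
    ∫⁻ t in Ioi (0 : ℝ), ENNReal.ofReal (t ^ n) *
        (expDensity rate (t • y) * ENNReal.ofReal (p (t • y))) ≤
      ∫⁻ t in Ioi (0 : ℝ), ENNReal.ofReal (t ^ n) * (expDensity rate (t • y) *
        (ENNReal.ofReal (GFun (n + 1) / (n + 1).factorial) *
          ∑ j, ENNReal.ofReal ((t • y) j))) := by
  rw [lintegral_ray_expDensity hr n hy fun t => ENNReal.ofReal (p (t • y)),
    lintegral_ray_expDensity hr n hy fun t =>
      ENNReal.ofReal (GFun (n + 1) / (n + 1).factorial) * ∑ j, ENNReal.ofReal ((t • y) j)]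
  gcongr ENNReal.ofReal (∏ j, rate j) * ?_
  calc _ = ∫⁻ t in Ioi (0 : ℝ), ENNReal.ofReal (t ^ n * Real.exp (-((∑ j, rate j * y j) * t))) *
        ENNReal.ofReal (t * s t - h t) :=
        lintegral_congr_ae (hp.mono fun t ht => by simp only [ht])
    _ ≤ _ := hu.lintegral_gammaWeight_payment_le n (sum_mul_pos_of_mem_orthant hr hy hy0)
    _ = _ := by
        rw [← lintegral_const_mul' _ _ ENNReal.ofReal_ne_top]
        refine setLIntegral_congr_fun measurableSet_Ioi fun t ht => ?_
        rw [sum_ofReal_smul hy ht, mul_left_comm]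

theorem lintegral_payment_expLaw_le {m : ℕ} (hm : 1 ≤ m) {rate : Fin m → ℝ}
    (hr : ∀ j, 0 < rate j) {p : (Fin m → ℝ) → ℝ}
    (hp : ∀ᵐ y : Metric.sphere (0 : Fin m → ℝ) 1 ∂(volume : Measure (Fin m → ℝ)).toSphere,
      (y : Fin m → ℝ) ∈ orthant m → ∃ h s, IsRayUtility (∑ j, (y : Fin m → ℝ) j) h s ∧
        ∀ᵐ t ∂(volume.restrict (Ioi (0 : ℝ))), p (t • (y : Fin m → ℝ)) = t * s t - h t) :
    ∫⁻ x, ENNReal.ofReal (p x) ∂(expLaw rate) ≤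
      ENNReal.ofReal (GFun m / m.factorial * ∑ j, 1 / rate j) := by
  obtain ⟨n, rfl⟩ := Nat.exists_eq_add_of_le' hm
  rw [ENNReal.ofReal_mul (div_nonneg (GFun_nonneg _) (by positivity)), ← lintegral_sum_expLaw hr,
    ← lintegral_const_mul' _ _ ENNReal.ofReal_ne_top, lintegral_expLaw hr, lintegral_expLaw hr]
  refine lintegral_le_lintegral_of_sphere volume
    ((measurable_expDensity rate).mul (by fun_prop)) (hp.mono fun y hy => ?_)
  rw [Module.finrank_fin_fun, add_tsub_cancel_right]
  by_cases hyD : (y : Fin (n + 1) → ℝ) ∈ orthant (n + 1)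
  · obtain ⟨h, s, hu, hpay⟩ := hy hyD
    exact lintegral_ray_payment_le hr hyD (ne_zero_of_mem_unit_sphere y) hu hpay
  · have hzero : ∀ t ∈ Ioi (0 : ℝ), ENNReal.ofReal (t ^ n) * (expDensity rate (t • ↑y) *
        ENNReal.ofReal (p (t • ↑y))) = 0 := fun t ht => by
      rw [expDensity, indicator_of_notMem (mt (smul_mem_orthant_iff ht).1 hyD), zero_mul, mul_zero]
    rw [setLIntegral_congr_fun measurableSet_Ioi hzero, lintegral_zero]
    exact zero_le

/-! ### Revenue bounds -/

lemma Mechanism.isRayUtility {m : ℕ} {M : Mechanism (orthant m)} (hIR : M.IsIR) (hIC : M.IsIC)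
    {y : Fin m → ℝ} (hy : y ∈ orthant m) :
    IsRayUtility (∑ j, y j) (fun t => M.utility (t • y) (t • y))
      fun t => ∑ j, M.alloc (t • y) j * y j := by
  have hmem : ∀ t : ℝ, 0 < t → t • y ∈ orthant m := fun t ht => (smul_mem_orthant_iff ht).2 hy
  refine ⟨fun t ht => hIR _ (hmem t ht), ?_, fun t ht t' ht' => ?_⟩
  · filter_upwards [ae_restrict_mem measurableSet_Ioi] with t ht
    have halloc := M.alloc_mem _ (hmem t ht)
    exact ⟨Finset.sum_nonneg fun j _ => mul_nonneg (halloc j).1 (hy j),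
      Finset.sum_le_sum fun j _ => mul_le_of_le_one_left (hy j) (halloc j).2⟩
  · refine le_of_eq_of_le ?_ (hIC (t' • y) (hmem t' ht') (t • y) (hmem t ht))
    simp only [Mechanism.utility, Pi.smul_apply, smul_eq_mul, mul_left_comm _ t,
      mul_left_comm _ t', ← Finset.mul_sum]
    ring

lemma Mechanism.expectedRevenue_expLaw_le {m : ℕ} (hm : 1 ≤ m) {rate : Fin m → ℝ}
    (hr : ∀ j, 0 < rate j) {M : Mechanism (orthant m)} (hIR : M.IsIR) (hIC : M.IsIC) :
    M.expectedRevenue (expLaw rate) ≤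
      ENNReal.ofReal (GFun m / m.factorial * ∑ j, 1 / rate j) := by
  refine lintegral_payment_expLaw_le hm hr (ae_of_all _ fun y hy =>
    ⟨_, _, Mechanism.isRayUtility hIR hIC hy, ae_of_all _ fun t => ?_⟩)
  simp only [Mechanism.utility, Pi.smul_apply, smul_eq_mul, mul_left_comm _ t, ← Finset.mul_sum]
  ring

lemma fderiv_apply_eq_sum_partialDeriv {m : ℕ} (u : (Fin m → ℝ) → ℝ) (x y : Fin m → ℝ) :
    fderiv ℝ u x y = ∑ j, partialDeriv u j x * y j := by
  conv_lhs => rw [pi_eq_sum_univ' y, map_sum]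
  refine Finset.sum_congr rfl fun j _ => ?_
  rw [map_smul, smul_eq_mul, mul_comm, partialDeriv]

lemma rightDeriv_ray_eq_sum_partialDeriv {m : ℕ} {u : (Fin m → ℝ) → ℝ} {y : Fin m → ℝ} {t : ℝ}
    (hd : DifferentiableAt ℝ u (t • y)) :
    derivWithin (fun t => u (t • y)) (Ioi t) t = ∑ j, partialDeriv u j (t • y) * y j := by
  have hray : HasDerivAt (fun t : ℝ => t • y) y t := by
    simpa using (hasDerivAt_id t).smul_const y
  rw [← fderiv_apply_eq_sum_partialDeriv]
  exact (hd.hasFDerivAt.comp_hasDerivAt t hray).hasDerivWithinAt.derivWithin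
    (uniqueDiffWithinAt_Ioi t)

lemma IsFeasibleUtility.isRayUtility {m : ℕ} {u : (Fin m → ℝ) → ℝ}
    (hu : IsFeasibleUtility (orthant m) u) {y : Fin m → ℝ} (hy : y ∈ orthant m)
    (hray : ∀ᵐ t ∂(volume.restrict (Ioi (0 : ℝ))),
      DifferentiableAt ℝ u (t • y) ∧ ∀ j, partialDeriv u j (t • y) ∈ Icc (0 : ℝ) 1) :
    IsRayUtility (∑ j, y j) (fun t => u (t • y))
      fun t => derivWithin (fun t => u (t • y)) (Ioi t) t := by
  have hmem : ∀ t : ℝ, 0 < t → t • y ∈ orthant m := fun t ht => (smul_mem_orthant_iff ht).2 hy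
  have hconv : ConvexOn ℝ (Ioi 0) fun t : ℝ => u (t • y) :=
    (hu.convex.comp_linearMap (LinearMap.toSpanSingleton ℝ (Fin m → ℝ) y)).subset hmem
      (convex_Ioi 0)
  refine ⟨fun t ht => hu.nonneg _ (hmem t ht), hray.mono fun t ht => ?_,
    isSubgradientOn_rightDeriv hconv isOpen_Ioi⟩
  rw [rightDeriv_ray_eq_sum_partialDeriv ht.1]
  exact ⟨Finset.sum_nonneg fun j _ => mul_nonneg (ht.2 j).1 (hy j),
    Finset.sum_le_sum fun j _ => mul_le_of_le_one_left (hy j) (ht.2 j).2⟩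

lemma IsFeasibleUtility.lintegral_expLaw_le {m : ℕ} (hm : 1 ≤ m) {rate : Fin m → ℝ}
    (hr : ∀ j, 0 < rate j) {u : (Fin m → ℝ) → ℝ} (hu : IsFeasibleUtility (orthant m) u) :
    ∫⁻ x, ENNReal.ofReal (∑ j, partialDeriv u j x * x j - u x) ∂(expLaw rate) ≤
      ENNReal.ofReal (GFun m / m.factorial * ∑ j, 1 / rate j) := by
  have : Nonempty (Fin m) := ⟨⟨0, hm⟩⟩
  have hdiff := (ae_restrict_iff' (measurableSet_orthant m)).1 hu.partialDeriv_mem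
  refine lintegral_payment_expLaw_le hm hr
    ((ae_ae_smul_sphere volume hdiff).mono fun y hy hyD => ?_)
  have hray : ∀ᵐ t ∂(volume.restrict (Ioi (0 : ℝ))), DifferentiableAt ℝ u (t • (y : Fin m → ℝ)) ∧
      ∀ j, partialDeriv u j (t • (y : Fin m → ℝ)) ∈ Icc (0 : ℝ) 1 := by
    filter_upwards [hy, ae_restrict_mem measurableSet_Ioi] with t ht ht0
    exact ht ((smul_mem_orthant_iff ht0).2 hyD)
  refine ⟨_, _, hu.isRayUtility hyD hray, hray.mono fun t ht => ?_⟩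
  rw [rightDeriv_ray_eq_sum_partialDeriv ht.1]
  simp only [Pi.smul_apply, smul_eq_mul, mul_left_comm _ t, ← Finset.mul_sum]

lemma integral_le_of_lintegral_ofReal_le {α : Type*} [MeasurableSpace α] {μ : Measure α}
    {f : α → ℝ} {b : ℝ} (hb : 0 ≤ b) (h : ∫⁻ x, ENNReal.ofReal (f x) ∂μ ≤ ENNReal.ofReal b) :
    ∫ x, f x ∂μ ≤ b := by
  by_cases hf : Integrable f μ
  · rw [integral_eq_lintegral_pos_part_sub_lintegral_neg_part hf]
    have := ENNReal.toReal_le_of_le_ofReal hb h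
    linarith [ENNReal.toReal_nonneg (a := ∫⁻ x, ENNReal.ofReal (-f x) ∂μ)]
  · rwa [integral_undef hf]

lemma revenueBound_nonneg {m : ℕ} {rate : Fin m → ℝ} (hr : ∀ j, 0 < rate j) :
    0 ≤ GFun m / m.factorial * ∑ j, 1 / rate j :=
  mul_nonneg (div_nonneg (GFun_nonneg m) (by positivity))
    (Finset.sum_nonneg fun j _ => (one_div_pos.2 (hr j)).le)

lemma optimalRevenue_expLaw_le {m : ℕ} (hm : 1 ≤ m) {rate : Fin m → ℝ} (hr : ∀ j, 0 < rate j) :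
    optimalRevenue (orthant m) (expLaw rate) ≤
      ((GFun m / m.factorial * ∑ j, 1 / rate j : ℝ) : EReal) := by
  refine iSup₂_le fun M hM => ?_
  have h := EReal.coe_ennreal_le_coe_ennreal_iff.2
    (M.expectedRevenue_expLaw_le hm hr hM.1 hM.2)
  rwa [EReal.coe_ennreal_ofReal, max_eq_left (revenueBound_nonneg hr)] at h

lemma optimalUtilityRevenue_expLaw_le {m : ℕ} (hm : 1 ≤ m) {rate : Fin m → ℝ}
    (hr : ∀ j, 0 < rate j) :
    optimalUtilityRevenue (orthant m) (expLaw rate) ≤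
      ((GFun m / m.factorial * ∑ j, 1 / rate j : ℝ) : EReal) := by
  refine iSup₂_le fun u hu => EReal.coe_le_coe_iff.2 ?_
  exact integral_le_of_lintegral_ofReal_le (revenueBound_nonneg hr)
    ((setLIntegral_le_lintegral _ _).trans (hu.lintegral_expLaw_le hm hr))

lemma revenueBound_const {m : ℕ} (hm : 1 ≤ m) {r : ℝ} (hr : 0 < r) :
    GFun m / m.factorial * ∑ _j : Fin m, 1 / r = GFun m / ((m - 1).factorial * r) := by
  obtain ⟨k, rfl⟩ := Nat.exists_eq_add_of_le' hm
  simp only [Finset.sum_const, Finset.card_univ, Fintype.card_fin, nsmul_eq_mul,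
    add_tsub_cancel_right, Nat.factorial_succ]
  push_cast
  field_simp

end OptimalSelling

theorem mainTheorem2 (m : ℕ) (hm : 1 ≤ m) :
    -- `gammaStar m` is the unique root of `g(m, ·)` on `[0, ∞)`
    (∀ w : ℝ, (0 ≤ w ∧ OptimalSelling.gFun m w = 0) ↔ w = OptimalSelling.gammaStar m) ∧
    -- the expressions for `G(m)`
    OptimalSelling.GFun m =
      ∫ w in Set.Ioi (OptimalSelling.gammaStar m), OptimalSelling.gFun m w ∧
    OptimalSelling.GFun m =
      OptimalSelling.gammaStar m * OptimalSelling.incGamma m (OptimalSelling.gammaStar m) ∧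
    OptimalSelling.GFun m =
      OptimalSelling.gammaStar m ^ (m + 1) * Real.exp (-OptimalSelling.gammaStar m) ∧
    -- independent exponential valuations
    (∀ rate : Fin m → ℝ, (∀ j, 0 < rate j) →
      OptimalSelling.optimalRevenue (OptimalSelling.orthant m) (OptimalSelling.expLaw rate) ≤
        ((OptimalSelling.GFun m / (m.factorial : ℝ) * ∑ j, 1 / rate j : ℝ) : EReal) ∧
      OptimalSelling.optimalUtilityRevenue (OptimalSelling.orthant m)
          (OptimalSelling.expLaw rate) ≤
        ((OptimalSelling.GFun m / (m.factorial : ℝ) * ∑ j, 1 / rate j : ℝ) : EReal)) ∧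
    -- i.i.d. exponential valuations
    (∀ r : ℝ, 0 < r →
      OptimalSelling.optimalRevenue (OptimalSelling.orthant m)
          (OptimalSelling.expLaw fun _ : Fin m => r) ≤
        ((OptimalSelling.GFun m / (((m - 1).factorial : ℝ) * r) : ℝ) : EReal) ∧
      OptimalSelling.optimalUtilityRevenue (OptimalSelling.orthant m)
          (OptimalSelling.expLaw fun _ : Fin m => r) ≤
        ((OptimalSelling.GFun m / (((m - 1).factorial : ℝ) * r) : ℝ) : EReal)) := by
  open OptimalSelling in
  exact ⟨eq_gammaStar_iff hm, GFun_eq_integral_gFun hm, GFun_eq_mul_incGamma hm,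
    GFun_eq_pow_mul_exp hm,
    fun rate hr => ⟨optimalRevenue_expLaw_le hm hr, optimalUtilityRevenue_expLaw_le hm hr⟩,
    fun r hr => by
      rw [← revenueBound_const hm hr]
      exact ⟨optimalRevenue_expLaw_le hm fun _ => hr,
        optimalUtilityRevenue_expLaw_le hm fun _ => hr⟩⟩
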